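/- Let $L$ be a countable first-order language and let $T$ be a complete $L$-theory whose set $S(T)=\bigcup_{n}S_n(T)$ of complete types over $\varnothing$ in finitely many variables has cardinality $2^{\omega}$ (the class of such theories is denoted $\mathcal T_c$). All models are nonempty. We use the following notions. - A formula is consistent with a theory $T'$ if it is satisfied by some tuple in some model of $T'$. An *i-formula* of $T'$ is a consistent formula $\varphi(\bar x)$ that belongs to an isolated complete type of $T'$ in the variables $\bar x$. For a finite tuple $\bar b$ of a model $M$, a formula $\varphi(\bar x,\bar b)$ is called consistent, or an i-formula, if it is so for the complete theory of $(M,\bar b)$, where $\bar b$ is named by new constants. - A model $M$ is *prime over a finite tuple* $\bar b\in M$ (equivalently, over the finite set of its entries) if for every structure $N$ and every tuple $\bar c\in N$ with $\operatorname{tp}^N(\bar c)=\operatorname{tp}^M(\bar b)$ there is an elementary embedding $M\to N$ taking $\bar b$ to $\bar c$. - A model $M$ is *limit* if it is not prime over any finite tuple, but $M=\bigcup_{n\in\omega}M_n$ for some elementary chain $M_0\preccurlyeq M_1\preccurlyeq\cdots$ of models each of which is prime over some finite tuple of its elements. - $T$ is *npl-zero* if the set of isomorphism types of countable models of $T$ that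 are neither prime over a finite tuple nor limit has cardinality $0$. Then: 1. A countable model $M$ of $T$ is prime over a finite set or limit if and only if every finite tuple $\bar a\in M$ extends to a finite tuple $\bar b\in M$ such that every consistent formula $\varphi(\bar x,\bar b)$ is an i-formula. 2. $T$ is npl-zero if and only if in every countable model $M$ of $T$ every finite tuple $\bar a\in M$ extends to a finite tuple $\bar b\in M$ such that every consistent formula $\varphi(\bar x,\bar b)$ is an i-formula. -/

import Mathlib

universe u v w

open FirstOrder Cardinal

namespace FirstOrder.Language

section Formulas

variable {L : Language.{u, v}}

/-- The formula `φ(x₀, …, x₍ₙ₋₁₎)` is consistent with `T`: it is satisfied by some tuple in some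
model of `T`. -/
def Theory.IsConsistentFormula (T : L.Theory) {n : ℕ} (φ : L.Formula (Fin n)) : Prop :=
  ∃ (N : Theory.ModelType.{u, v, max u v} T) (c : Fin n → N), φ.Realize c

/-- A complete type is isolated (principal) if it is the only complete type of `T`, in the same
variables, that contains a certain formula. -/
def Theory.CompleteType.IsIsolated {T : L.Theory} {n : ℕ} (p : T.CompleteType (Fin n)) : Prop :=
  ∃ ψ : L.Formula (Fin n), Formula.equivSentence ψ ∈ p ∧
    ∀ q : T.CompleteType (Fin n), Formula.equivSentence ψ ∈ q → q = p

/-- An i-formula of `T`: a consistent formula that belongs to some isolated complete type. -/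
def Theory.IsIFormula (T : L.Theory) {n : ℕ} (φ : L.Formula (Fin n)) : Prop :=
  T.IsConsistentFormula φ ∧
    ∃ p : T.CompleteType (Fin n), p.IsIsolated ∧ Formula.equivSentence φ ∈ p

/-- The class of countable complete theories with continuum many types, where
`S(T) = ⋃ₙ Sₙ(T)` is the set of all complete types of `T` in finitely many variables. -/
structure Theory.IsUnsmall (T : L.Theory) : Prop where
  countable : Countable L.Symbols
  complete : T.IsComplete
  card_types : #(Σ n : ℕ, T.CompleteType (Fin n)) = 𝔠

end Formulas

section Models

variable (L : Language.{u, v}) {M : Type w} [L.Structure M]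

/-- The complete theory of the expansion `(M, b̄)` of `M` by constants naming the entries of the
tuple `b̄`. Formulas `φ(x̄, b̄)` are formulas of its language `L[[Fin m]]`. -/
def tupleTheory {m : ℕ} (b : Fin m → M) : L[[Fin m]].Theory :=
  letI : (constantsOn (Fin m)).Structure M := constantsOn.structure b
  L[[Fin m]].completeTheory M

/-- Every consistent formula `φ(x̄, b̄)` is an i-formula (of the theory of `(M, b̄)`). -/
def AllConsistentAreIFormulas {m : ℕ} (b : Fin m → M) : Prop :=
  ∀ (n : ℕ) (φ : L[[Fin m]].Formula (Fin n)),
    (L.tupleTheory b).IsConsistentFormula φ → (L.tupleTheory b).IsIFormula φ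

/-- `M` is prime over the tuple `b̄`: it embeds elementarily, with `b̄` sent to `c̄`, into every
structure `N` with a tuple `c̄` that has the same complete type as `b̄`. -/
def IsPrimeOver {m : ℕ} (b : Fin m → M) : Prop :=
  ∀ (N : Type w) [L.Structure N] (c : Fin m → N),
    (∀ φ : L.Formula (Fin m), φ.Realize b ↔ φ.Realize c) →
      ∃ f : M ↪ₑ[L] N, ⇑f ∘ b = c

variable (M)

/-- `M` is prime over some finite tuple of its elements, that is, over the finite set of the
entries of such a tuple. -/
def IsPrimeOverFinite : Prop :=
  ∃ (m : ℕ) (b : Fin m → M), L.IsPrimeOver b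

variable {L M} in
/-- An elementary chain `S₀ ≼ S₁ ≼ S₂ ≼ …` of substructures of `M`. -/
structure IsElementaryChain (S : ℕ → L.Substructure M) : Prop where
  le_succ : ∀ n, S n ≤ S (n + 1)
  elementary : ∀ (n k : ℕ) (φ : L.Formula (Fin k)) (x : Fin k → S n),
    φ.Realize (⇑(Substructure.inclusion (le_succ n)) ∘ x) ↔ φ.Realize x

/-- `M` is a limit model: it is not prime over a tuple, and it is the union of an elementary chain
of models each of which is prime over a tuple. -/
def IsLimitModel : Prop :=
  ¬ L.IsPrimeOverFinite M ∧
    ∃ S : ℕ → L.Substructure M, IsElementaryChain S ∧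
      (∀ n, L.IsPrimeOverFinite (S n)) ∧ ∀ x : M, ∃ n, x ∈ S n

/-- Every tuple `ā` of `M` extends to a tuple `b̄ = ā ⌢ c̄` of `M` such that every consistent formula
`φ(x̄, b̄)` is an i-formula. -/
def TuplesExtendToIFormulaTuples : Prop :=
  ∀ (n : ℕ) (a : Fin n → M), ∃ (k : ℕ) (c : Fin k → M),
    L.AllConsistentAreIFormulas (Fin.append a c)

end Models

section Counting

variable {L : Language.{u, v}}

/-- The countable models of `T`. -/
def Theory.CountableModel (T : L.Theory) :=
  { M : Theory.ModelType.{u, v, w} T // Countable M }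

/-- Isomorphism of countable models. -/
def Theory.countableModelSetoid (T : L.Theory) : Setoid (Theory.CountableModel.{u, v, w} T) where
  r M N := Nonempty (M.1 ≃[L] N.1)
  iseqv :=
    ⟨fun M => ⟨Equiv.refl L M.1⟩, fun ⟨e⟩ => ⟨e.symm⟩, fun ⟨e⟩ ⟨f⟩ => ⟨f.comp e⟩⟩

/-- The set **NPL**(T) of isomorphism types of countable models of `T` that are neither prime over
a tuple nor limit. -/
def Theory.nplSet (T : L.Theory) : Set (Quotient (Theory.countableModelSetoid.{u, v, w} T)) :=
  { c | ∃ M : Theory.CountableModel.{u, v, w} T, Quotient.mk _ M = c ∧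
      ¬ L.IsPrimeOverFinite M.1 ∧ ¬ L.IsLimitModel M.1 }

/-- `T` is npl-zero: the number of its countable models that are neither prime over a tuple nor
limit, counted up to isomorphism, is zero. -/
def Theory.IsNplZero (T : L.Theory) : Prop :=
  #(Theory.nplSet.{u, v, w} T) = 0

end Counting

end FirstOrder.Language

/-! Call a finite set `B` of parameters good if the isolated types over `B` are dense; this is the
condition that every consistent formula over `B` is an i-formula.

If `M` is prime over `b`, then `M` is atomic over `b`: a non-isolated type over `b` can be omitted
in some structure. Hence every finite set containing `b` is good, and goodness passes from an
elementary substructure to `M`, which settles limit models.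

Conversely, suppose that every finite subset of a countable `M` lies in a good one, and approximate
the chain by finite chains `B₀ ⊆ ⋯ ⊆ Bₖ` of good sets. When a formula over `Bᵢ` needs a witness,
goodness of `Bᵢ`, `Bᵢ₊₁`, …, `Bₖ` in turn shrinks its solution set until it contains an `x` whose
types over all these sets are isolated. Adding `x` to all of them keeps each `Bⱼ` good and atomic
over its initial value, so in the limit the members are elementary substructures that are atomic,
hence prime, over finite sets.
-/

namespace PrimeModels

open FirstOrder.Language Set Filter

section SameType

variable {L : FirstOrder.Language.{u, v}} {M N : Type*} [L.Structure M] [L.Structure N]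
variable {α β : Type*}

variable (L) in
/-- Two tuples, possibly from different structures, have the same complete type over `∅`. -/
def SameType (x : α → M) (y : α → N) : Prop :=
  ∀ φ : L.Formula α, φ.Realize x ↔ φ.Realize y

variable {x : α → M} {y : α → N}

theorem sameType_of_forall_imp (h : ∀ φ : L.Formula α, φ.Realize x → φ.Realize y) :
    SameType L x y :=
  fun φ => ⟨h φ, fun hy => by_contra fun hx => h φ.not hx hy⟩

theorem SameType.comp (h : SameType L x y) (f : β → α) : SameType L (x ∘ f) (y ∘ f) := fun φ => by
  simpa only [Formula.realize_relabel] using h (φ.relabel f)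

theorem SameType.apply_eq_apply_iff (h : SameType L x y) (i j : α) : x i = x j ↔ y i = y j := by
  simpa only [Formula.realize_equal, Term.realize_var] using
    h ((Term.var i).equal (Term.var j))

theorem SameType.exists_realize_iff [Finite β] (h : SameType L x y) (φ : L.Formula (α ⊕ β)) :
    (∃ d : β → M, φ.Realize (Sum.elim x d)) ↔ ∃ e : β → N, φ.Realize (Sum.elim y e) := by
  simpa only [Formula.realize_iExs] using h (φ.iExs β)

theorem sameType_sumElim_iff_of_isEmpty [IsEmpty α] {d : β → M} {e : β → N} :
    SameType L (Sum.elim x d) (Sum.elim y e) ↔ SameType L d e := by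
  refine ⟨fun h => h.comp Sum.inr, fun h => ?_⟩
  have h' := h.comp (Sum.elim isEmptyElim id : α ⊕ β → β)
  rwa [Sum.comp_elim, Sum.comp_elim, Subsingleton.elim (d ∘ isEmptyElim) x,
    Subsingleton.elim (e ∘ isEmptyElim) y] at h'

theorem realize_restrictFreeVar_id [DecidableEq α] (φ : L.Formula α) (x : α → M) :
    Formula.Realize (φ.restrictFreeVar id) (x ∘ ((↑) : φ.freeVarFinset → α)) ↔ φ.Realize x :=
  BoundedFormula.realize_restrictFreeVar x fun _ => rfl

theorem sameType_of_forall_finset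
    (h : ∀ s : Finset α, SameType L (x ∘ ((↑) : s → α)) (y ∘ ((↑) : s → α))) :
    SameType L x y := by
  classical
  intro φ
  simpa only [realize_restrictFreeVar_id] using h φ.freeVarFinset (φ.restrictFreeVar id)

theorem sameType_comp_elementaryEmbedding (f : M ↪ₑ[L] N) (x : α → M) : SameType L x (f ∘ x) :=
  fun φ => (f.map_formula φ x).symm

theorem SameType.exists_elementaryEmbedding {b : α → M} {c : α → N} {f : M → N}
    (h : SameType L (Sum.elim b id) (Sum.elim c f)) : ∃ F : M ↪ₑ[L] N, F ∘ b = c := by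
  refine ⟨⟨f, fun n φ x => (h.comp (Sum.inr ∘ x) φ).symm⟩, funext fun i => ?_⟩
  exact ((h.apply_eq_apply_iff (Sum.inl i) (Sum.inr (b i))).1 rfl).symm

end SameType

section IsolatedTypes

variable {L : FirstOrder.Language.{u, v}} {M : Type*} [L.Structure M] {A B : Set M}
variable {α β : Type*}

variable (L) in
/-- The complete type of the tuple `d` over the parameter set `A` is isolated: among the
`A`-definable sets that contain `d` there is a least one. -/
def IsIsolatedOver (A : Set M) (d : α → M) : Prop :=
  ∃ s : Set (α → M), A.Definable L s ∧ d ∈ s ∧ ∀ t, A.Definable L t → d ∈ t → s ⊆ t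

variable (L) in
/-- The isolated types over `A` are dense among the types over `A` in finitely many variables. -/
def IsolatedTypesDense (A : Set M) : Prop :=
  ∀ (n : ℕ) (s : Set (Fin n → M)), A.Definable L s → s.Nonempty → ∃ d ∈ s, IsIsolatedOver L A d

variable (L) in
/-- The structure is atomic over the parameter set `A`. -/
def IsAtomicOver (A : Set M) : Prop :=
  ∀ (n : ℕ) (d : Fin n → M), IsIsolatedOver L A d

theorem subset_of_isolates {s t : Set (α → M)} {d e : α → M}
    (h : ∀ t, A.Definable L t → d ∈ t → s ⊆ t) (he : e ∈ s) (ht : A.Definable L t) (het : e ∈ t) :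
    s ⊆ t := by
  by_cases hd : d ∈ t
  · exact h t ht hd
  · exact absurd het (h _ ht.compl hd he)

theorem definable_union_range_iff {d : α → M} {t : Set (β → M)} :
    (B ∪ range d).Definable L t ↔
      ∃ t' : Set (α ⊕ β → M), B.Definable L t' ∧ t = {e | Sum.elim d e ∈ t'} := by
  simp only [definable_iff_exists_formula_sum]
  constructor
  · rintro ⟨φ, rfl⟩
    have hg : ∀ c : ↥(B ∪ range d), ∃ x : B ⊕ α, Sum.elim (↑) d x = (c : M) := by
      rintro ⟨c, hc | ⟨a, rfl⟩⟩
      exacts [⟨Sum.inl ⟨c, hc⟩, rfl⟩, ⟨Sum.inr a, rfl⟩]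
    choose g hg using hg
    refine ⟨_, ⟨φ.relabel (_root_.Equiv.sumAssoc B α β ∘ Sum.map g id), rfl⟩, ?_⟩
    ext e
    simp only [mem_ofPred_eq, Formula.realize_relabel]
    refine iff_of_eq (congrArg _ (funext ?_))
    rintro (c | c)
    · rw [Sum.elim_inl, ← hg c]
      rcases hgc : g c with x | x <;> simp [hgc]
    · simp
  · rintro ⟨_, ⟨φ, rfl⟩, rfl⟩
    refine ⟨φ.relabel (Sum.elim (fun c : B => Sum.inl ⟨c, Or.inl c.2⟩)
      (Sum.elim (fun a => Sum.inl ⟨d a, Or.inr ⟨a, rfl⟩⟩) Sum.inr)), ?_⟩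
    ext e
    simp only [mem_ofPred_eq, Formula.realize_relabel]
    refine iff_of_eq (congrArg _ (funext ?_))
    rintro (c | c | c) <;> rfl

theorem definable_range_iff {d : α → M} {t : Set (β → M)} :
    (range d).Definable L t ↔ ∃ φ : L.Formula (α ⊕ β), t = {e | φ.Realize (Sum.elim d e)} := by
  rw [← empty_union (range d), definable_union_range_iff]
  simp only [empty_definable_iff]
  constructor
  · rintro ⟨_, ⟨φ, rfl⟩, rfl⟩
    exact ⟨φ, rfl⟩
  · rintro ⟨φ, rfl⟩
    exact ⟨_, ⟨φ, rfl⟩, rfl⟩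

theorem isIsolatedOver_range_iff {b : α → M} {d : β → M} :
    IsIsolatedOver L (range b) d ↔ ∃ ψ : L.Formula (α ⊕ β), ψ.Realize (Sum.elim b d) ∧
      ∀ e, ψ.Realize (Sum.elim b e) → SameType L (Sum.elim b d) (Sum.elim b e) := by
  simp only [IsIsolatedOver, definable_range_iff]
  constructor
  · rintro ⟨_, ⟨ψ, rfl⟩, hd, h⟩
    exact ⟨ψ, hd, fun e he => sameType_of_forall_imp fun χ hχ => h _ ⟨χ, rfl⟩ hχ he⟩
  · rintro ⟨ψ, hd, h⟩
    refine ⟨_, ⟨ψ, rfl⟩, hd, ?_⟩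
    rintro _ ⟨χ, rfl⟩ hχ e he
    exact (h e he χ).1 hχ

theorem isIsolatedOver_empty_iff {d : α → M} :
    IsIsolatedOver L (∅ : Set M) d ↔
      ∃ ψ : L.Formula α, ψ.Realize d ∧ ∀ e : α → M, ψ.Realize e → SameType L d e := by
  simp only [IsIsolatedOver, empty_definable_iff]
  constructor
  · rintro ⟨_, ⟨ψ, rfl⟩, hd, h⟩
    exact ⟨ψ, hd, fun e he => sameType_of_forall_imp fun χ hχ => h _ ⟨χ, rfl⟩ hχ he⟩
  · rintro ⟨ψ, hd, h⟩
    refine ⟨_, ⟨ψ, rfl⟩, hd, ?_⟩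
    rintro _ ⟨χ, rfl⟩ hχ e he
    exact (h e he χ).1 hχ

theorem IsIsolatedOver.comp [Finite α] [Finite β] {d : α → M} (h : IsIsolatedOver L A d)
    (f : β → α) : IsIsolatedOver L A (d ∘ f) := by
  obtain ⟨s, hs, hd, h⟩ := h
  refine ⟨_, hs.image_comp f, ⟨d, hd, rfl⟩, fun t ht hdt => ?_⟩
  rintro _ ⟨e, he, rfl⟩
  exact h _ (ht.preimage_comp f) hdt he

theorem IsAtomicOver.isIsolatedOver [Finite α] (h : IsAtomicOver L A) (d : α → M) :
    IsIsolatedOver L A d := by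
  obtain ⟨n, ⟨e⟩⟩ := Finite.exists_equiv_fin α
  simpa [Function.comp_assoc] using (h n (d ∘ e.symm)).comp e

theorem IsIsolatedOver.sumElim [Finite β] {d : α → M} {e : β → M} (hd : IsIsolatedOver L A d)
    (he : IsIsolatedOver L (A ∪ range d) e) : IsIsolatedOver L A (Sum.elim d e) := by
  obtain ⟨s, hs, hds, hs'⟩ := hd
  obtain ⟨_, ht, het, ht'⟩ := he
  obtain ⟨t, htA, rfl⟩ := definable_union_range_iff.1 ht
  refine ⟨_, (hs.preimage_comp Sum.inl).inter htA, ⟨hds, het⟩, fun r hr her x hx => ?_⟩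
  have htr : ∀ z, Sum.elim d z ∈ tᶜ ∪ r := fun z => by
    by_cases hz : Sum.elim d z ∈ t
    · exact Or.inr (ht' _ (definable_union_range_iff.2 ⟨r, hr, rfl⟩) her hz)
    · exact Or.inl hz
  have hxr := hs' _ (htA.compl.union hr).forall_of_finite htr hx.1 (x ∘ Sum.inr)
  rw [Sum.elim_comp_inl_inr] at hxr
  exact hxr.resolve_left fun h => h hx.2

theorem IsIsolatedOver.of_sumElim {d : α → M} {e : β → M}
    (h : IsIsolatedOver L A (Sum.elim d e)) : IsIsolatedOver L (A ∪ range d) e := by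
  obtain ⟨s, hs, hes, hs'⟩ := h
  refine ⟨_, definable_union_range_iff.2 ⟨s, hs, rfl⟩, hes, fun t ht het => ?_⟩
  obtain ⟨t, htA, rfl⟩ := definable_union_range_iff.1 ht
  exact fun x hx => hs' _ htA het hx

theorem definable_singleton_of_forall_mem [Finite α] {d : α → M} (hd : ∀ i, d i ∈ A) :
    A.Definable L {d} := by
  have hinter : ({d} : Set (α → M)) = ⋂ i, (fun g : α → M => g ∘ fun _ : Fin 1 => i) ⁻¹'
      {x : Fin 1 → M | x 0 ∈ ({d i} : Set M)} := by
    ext x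
    simp [funext_iff]
  rw [hinter]
  exact definable_iInter_of_finite fun i =>
    (Definable.singleton_of_mem L (hd i)).preimage_comp _

theorem isIsolatedOver_of_forall_mem [Finite α] {d : α → M} (hd : ∀ i, d i ∈ A) :
    IsIsolatedOver L A d :=
  ⟨{d}, definable_singleton_of_forall_mem hd, rfl, fun _ _ hdt => singleton_subset_iff.2 hdt⟩

theorem IsIsolatedOver.of_forall_mem_union [Finite α] [Finite β] {d : α → M}
    (hd : IsIsolatedOver L A d) {e : β → M} (he : ∀ i, e i ∈ A ∪ range d) :
    IsIsolatedOver L A e :=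
  (hd.sumElim (isIsolatedOver_of_forall_mem he)).comp Sum.inr

theorem IsAtomicOver.isolatedTypesDense_union_range [Finite α] (h : IsAtomicOver L A)
    (d : α → M) : IsolatedTypesDense L (A ∪ range d) := by
  rintro n s - ⟨e, he⟩
  exact ⟨e, he, (h.isIsolatedOver (Sum.elim d e)).of_sumElim⟩

theorem IsolatedTypesDense.exists_isIsolatedOver [Finite α] (h : IsolatedTypesDense L A)
    {s : Set (α → M)} (hs : A.Definable L s) (hne : s.Nonempty) :
    ∃ d ∈ s, IsIsolatedOver L A d := by
  obtain ⟨n, ⟨e⟩⟩ := Finite.exists_equiv_fin α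
  obtain ⟨d₀, hd₀⟩ := hne
  obtain ⟨d, hd, hi⟩ := h n _ (hs.preimage_comp e) ⟨d₀ ∘ e.symm, by
    simpa [Function.comp_assoc] using hd₀⟩
  exact ⟨d ∘ e, hd, hi.comp e⟩

theorem IsolatedTypesDense.union_range [Finite α] {d : α → M} (hA : IsolatedTypesDense L A)
    (hd : IsIsolatedOver L A d) : IsolatedTypesDense L (A ∪ range d) := by
  rintro n s hs ⟨e, he⟩
  obtain ⟨t, htA, rfl⟩ := definable_union_range_iff.1 hs
  obtain ⟨p, hp, hdp, hp'⟩ := hd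
  obtain ⟨x, ⟨hxp, hxt⟩, r, hr, hxr, hr'⟩ := hA.exists_isIsolatedOver
    ((hp.preimage_comp Sum.inl).inter htA) ⟨Sum.elim d e, hdp, he⟩
  obtain ⟨z, hzr, hzt⟩ := subset_of_isolates hp' hxp (hr.inter htA).exists_of_finite
    ⟨x ∘ Sum.inr, by rw [Sum.elim_comp_inl_inr]; exact ⟨hxr, hxt⟩⟩ hdp
  exact ⟨z, hzt, IsIsolatedOver.of_sumElim
    ⟨r, hr, hzr, fun t ht hzt => subset_of_isolates hr' hzr ht hzt⟩⟩

end IsolatedTypes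

section Extension

variable {L : FirstOrder.Language.{u, v}} {M N : Type*} [L.Structure M] [L.Structure N]
variable {α β : Type*} [Finite β] {b : α → M} {c : α → N} {d : β → M}

theorem SameType.sumElim_of_isolates (h : SameType L b c) {ψ : L.Formula (α ⊕ β)}
    (hψ : ∀ e, ψ.Realize (Sum.elim b e) → SameType L (Sum.elim b d) (Sum.elim b e)) {e : β → N}
    (he : ψ.Realize (Sum.elim c e)) : SameType L (Sum.elim b d) (Sum.elim c e) := by
  refine sameType_of_forall_imp fun χ hχ => by_contra fun hχe => ?_
  obtain ⟨e', he'⟩ := (h.exists_realize_iff (ψ ⊓ χ.not)).2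
    ⟨e, Formula.realize_inf.2 ⟨he, hχe⟩⟩
  rw [Formula.realize_inf] at he'
  exact he'.2 ((hψ e' he'.1 χ).1 hχ)

theorem SameType.exists_sumElim (h : SameType L b c) (hd : IsIsolatedOver L (range b) d) :
    ∃ e : β → N, SameType L (Sum.elim b d) (Sum.elim c e) := by
  obtain ⟨ψ, hψd, hψ⟩ := isIsolatedOver_range_iff.1 hd
  obtain ⟨e, he⟩ := (h.exists_realize_iff ψ).1 ⟨d, hψd⟩
  exact ⟨e, h.sumElim_of_isolates hψ he⟩

end Extension

section AtomicIsPrime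

theorem exists_seq_of_forall_snoc {N : Type*} {P : ∀ n, (Fin n → N) → Prop}
    (h0 : P 0 Fin.elim0) (hs : ∀ n g, P n g → ∃ y, P (n + 1) (Fin.snoc g y)) :
    ∃ g : ℕ → N, ∀ n, P n fun i => g i := by
  have : Nonempty N := ⟨(hs 0 _ h0).choose⟩
  choose! y hy using hs
  let g : ℕ → N := fun n => Nat.strongRecOn n fun n ih => y n fun i => ih i i.2
  have hg : ∀ n, g n = y n fun i => g i := fun n => Nat.strongRecOn_eq ..
  refine ⟨g, fun n => ?_⟩
  induction n with
  | zero => rwa [Subsingleton.elim (fun i : Fin 0 => g i) Fin.elim0]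
  | succ n ih =>
    have := hy n _ ih
    rw [← hg n] at this
    rwa [← Fin.snoc_init_self fun i : Fin (n + 1) => g i]

variable {L : FirstOrder.Language.{u, v}} {M N : Type w} [L.Structure M] [L.Structure N]
variable {m : ℕ} {b : Fin m → M} {c : Fin m → N}

theorem SameType.exists_snoc {n : ℕ} {d : Fin n → M} {g : Fin n → N}
    (h : SameType L (Sum.elim b d) (Sum.elim c g)) (hb : IsAtomicOver L (range b)) (x : M) :
    ∃ y : N, SameType L (Sum.elim b (Fin.snoc d x : Fin (n + 1) → M))
      (Sum.elim c (Fin.snoc g y : Fin (n + 1) → N)) := by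
  have hx : IsIsolatedOver L (range (Sum.elim b d)) fun _ : Fin 1 => x := by
    rw [Sum.elim_range]
    exact (hb.isIsolatedOver _).of_sumElim
  obtain ⟨y, hy⟩ := h.exists_sumElim hx
  let r : Fin m ⊕ Fin (n + 1) → (Fin m ⊕ Fin n) ⊕ Fin 1 :=
    Sum.elim (Sum.inl ∘ Sum.inl) (Fin.snoc (Sum.inl ∘ Sum.inr) (Sum.inr 0))
  have hr : ∀ {K : Type w} (p : Fin m → K) (q : Fin n → K) (z : Fin 1 → K),
      Sum.elim (Sum.elim p q) z ∘ r = Sum.elim p (Fin.snoc q (z 0) : Fin (n + 1) → K) := by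
    intro K p q z
    rw [Sum.comp_elim, Fin.comp_snoc]
    rfl
  exact ⟨y 0, by simpa only [hr] using hy.comp r⟩

theorem sameType_sumElim_of_forall_fin {e : ℕ → M} {g : ℕ → N}
    (h : ∀ n, SameType L (Sum.elim b fun i : Fin n => e i) (Sum.elim c fun i : Fin n => g i)) :
    SameType L (Sum.elim b e) (Sum.elim c g) := by
  refine sameType_of_forall_finset fun s => ?_
  obtain ⟨n, hn⟩ : ∃ n, ∀ i ∈ s.toRight, i < n :=
    ⟨s.toRight.sup id + 1, fun i hi => Nat.lt_succ_of_le (Finset.le_sup (f := id) hi)⟩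
  let r : s → Fin m ⊕ Fin n
    | ⟨Sum.inl i, _⟩ => Sum.inl i
    | ⟨Sum.inr i, hi⟩ => Sum.inr ⟨i, hn i (Finset.mem_toRight.2 hi)⟩
  have hr : ∀ {K : Type w} (p : Fin m → K) (q : ℕ → K),
      Sum.elim p (fun i : Fin n => q i) ∘ r = Sum.elim p q ∘ (↑) :=
    fun p q => by ext ⟨i | i, _⟩ <;> rfl
  simpa only [hr] using (h n).comp r

theorem IsAtomicOver.exists_seq (hb : IsAtomicOver L (range b)) (hbc : SameType L b c)
    (e : ℕ → M) : ∃ g : ℕ → N, SameType L (Sum.elim b e) (Sum.elim c g) := by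
  obtain ⟨g, hg⟩ := exists_seq_of_forall_snoc
    (P := fun n g => SameType L (Sum.elim b fun i : Fin n => e i) (Sum.elim c g))
    (by
      have h0 := hbc.comp (Sum.elim id isEmptyElim : Fin m ⊕ Fin 0 → Fin m)
      rw [Sum.comp_elim, Sum.comp_elim] at h0
      convert! h0 using 2)
    fun n g hg => by
      rw [← Fin.snoc_init_self fun i : Fin (n + 1) => e i]
      exact hg.exists_snoc hb (e n)
  exact ⟨g, sameType_sumElim_of_forall_fin hg⟩

theorem IsAtomicOver.isPrimeOver [Countable M] [Nonempty M] (hb : IsAtomicOver L (range b)) :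
    L.IsPrimeOver b := by
  intro N _ c hbc
  obtain ⟨e, he⟩ := exists_surjective_nat M
  obtain ⟨ρ, hρ⟩ := he.hasRightInverse
  obtain ⟨g, hg⟩ := hb.exists_seq hbc e
  have hid : SameType L (Sum.elim b id) (Sum.elim c (g ∘ ρ)) := by
    simpa only [Sum.elim_comp_map, Function.comp_id, hρ.comp_eq_id] using hg.comp (Sum.map id ρ)
  exact hid.exists_elementaryEmbedding

end AtomicIsPrime

theorem exists_generic_seq {P ι : Type*} [Preorder P] [Nonempty P] [Countable ι] {D : ι → Set P}
    (hD : ∀ i, IsCofinal (D i)) :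
    ∃ f : ℕ → P, Monotone f ∧ ∀ i, ∃ᶠ n in atTop, f n ∈ D i := by
  have := Encodable.ofCountable ι
  let 𝒟 : ι × ℕ → Order.Cofinal P := fun p => ⟨D p.1, hD p.1⟩
  let p₀ : P := Classical.arbitrary P
  refine ⟨Order.sequenceOfCofinals p₀ 𝒟, Order.sequenceOfCofinals.monotone p₀ 𝒟, fun i =>
    frequently_atTop.2 fun k => ⟨_, ?_, Order.sequenceOfCofinals.encode_mem p₀ 𝒟 (i, k)⟩⟩
  rw [Encodable.encode_prod_val]
  exact (Nat.right_le_pair _ _).trans (Nat.le_succ _)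

section FiniteSupport

variable {L : FirstOrder.Language.{u, v}} {M : Type*} [L.Structure M] {A : Set M} {α β : Type*}

theorem realize_iff_of_eqOn_freeVarFinset [DecidableEq α] {φ : L.Formula α} {x y : α → M}
    (h : EqOn x y φ.freeVarFinset) : φ.Realize x ↔ φ.Realize y := by
  have hxy : x ∘ ((↑) : φ.freeVarFinset → α) = y ∘ (↑) := funext fun i => h i.2
  rw [← realize_restrictFreeVar_id φ x, hxy, realize_restrictFreeVar_id]

theorem definable_image_comp_of_finite [Nonempty M] [Finite β] {X : Set (α → M)}
    (hX : A.Definable L X) (f : β → α) : A.Definable L ((fun x : α → M => x ∘ f) '' X) := by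
  classical
  obtain ⟨φ, rfl⟩ := hX
  have := Fintype.ofFinite β
  let F : Finset α := φ.freeVarFinset
  let G : Finset α := F ∪ Finset.univ.image f
  let i : F → G := fun a => ⟨a, Finset.mem_union_left _ a.2⟩
  let g : β → G := fun j => ⟨f j, Finset.mem_union_right _ (Finset.mem_image_of_mem f
    (Finset.mem_univ j))⟩
  let Y : Set (F → M) := {y | Formula.Realize (φ.restrictFreeVar id) y}
  have hY : A.Definable L Y := ⟨φ.restrictFreeVar id, rfl⟩
  have hφ : {x | φ.Realize x} =
      (fun x : α → M => x ∘ ((↑) : G → α)) ⁻¹' ((fun y : G → M => y ∘ i) ⁻¹' Y) := by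
    ext x
    exact (realize_restrictFreeVar_id φ x).symm
  have hsurj : Function.Surjective fun x : α → M => x ∘ ((↑) : G → α) :=
    Subtype.val_injective.surjective_comp_right
  have hfg : (fun x : α → M => x ∘ f) = (fun y : G → M => y ∘ g) ∘ fun x => x ∘ (↑) := rfl
  rw [hφ, hfg, image_comp, image_preimage_eq _ hsurj]
  exact (hY.preimage_comp i).image_comp g

end FiniteSupport

section Generic

variable {L : FirstOrder.Language.{u, v}} {M : Type w} [L.Structure M] {α β ι κ : Type*}

/-- Satisfying `witnessFormula φ i` means that the value of the variable `i` is a Henkin witness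
for `∃ x, φ`, provided that there is a witness at all. -/
noncomputable def witnessFormula (φ : L.Formula ((α ⊕ ι) ⊕ Fin 1)) (i : ι) : L.Formula (α ⊕ ι) :=
  (φ.iExs (Fin 1)).imp (φ.relabel (Sum.elim id fun _ => Sum.inr i))

theorem realize_witnessFormula {φ : L.Formula ((α ⊕ ι) ⊕ Fin 1)} {i : ι} {x : α ⊕ ι → M} :
    (witnessFormula φ i).Realize x ↔
      ((∃ y : Fin 1 → M, φ.Realize (Sum.elim x y)) →
        φ.Realize (Sum.elim x fun _ => x (Sum.inr i))) := by
  rw [witnessFormula, Formula.realize_imp, Formula.realize_iExs, Formula.realize_relabel,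
    Sum.comp_elim]
  rfl

variable {b : α → M}

theorem exists_realize_witnessFormula [Infinite ι] (φ : L.Formula ((α ⊕ ι) ⊕ Fin 1))
    {X : Set (ι → M)} (hX : (range b).Definable L X) (hne : X.Nonempty) :
    ∃ i, ∃ z ∈ X, (witnessFormula φ i).Realize (Sum.elim b z) := by
  classical
  obtain ⟨ψ, rfl⟩ := hX
  obtain ⟨z, hz⟩ := hne
  by_cases h : ∃ y : Fin 1 → M, φ.Realize (Sum.elim (Sum.elim b z) y)
  · obtain ⟨y, hy⟩ := h
    obtain ⟨i, hi⟩ :=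
      Infinite.exists_notMem_finset (ψ.freeVarFinset ∪ φ.freeVarFinset.toLeft.toRight)
    rw [Finset.mem_union, not_or, Finset.mem_toRight, Finset.mem_toLeft] at hi
    have hupdate : ∀ j ≠ i, z j = Function.update z i (y 0) j := fun j hj =>
      (Function.update_of_ne hj _ _).symm
    refine ⟨i, Function.update z i (y 0), (realize_iff_of_eqOn_freeVarFinset ?_).1 hz,
      realize_witnessFormula.2 fun _ => (realize_iff_of_eqOn_freeVarFinset ?_).1 hy⟩
    · exact fun j hj => hupdate j (ne_of_mem_of_not_mem hj hi.1)
    · rintro ((a | j) | k) hj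
      · rfl
      · exact hupdate j fun hji => hi.2 (hji ▸ hj)
      · obtain rfl := Subsingleton.elim k 0
        exact (Function.update_self i (y 0) z).symm
  · exact ⟨Classical.arbitrary ι, z, hz, realize_witnessFormula.2 fun hy => absurd hy h⟩

theorem exists_realize_and_exists_not_realize [Nonempty M] [Finite β] {d : β → M}
    (hd : ¬ IsIsolatedOver L (range b) d) {X : Set (ι → M)} (hX : (range b).Definable L X)
    (hne : X.Nonempty) (f : β → ι) :
    ∃ θ : L.Formula (α ⊕ β), θ.Realize (Sum.elim b d) ∧
      ∃ z ∈ X, ¬ θ.Realize (Sum.elim b (z ∘ f)) := by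
  by_contra! h
  have himage := definable_image_comp_of_finite hX f
  have hsub : ∀ t, (range b).Definable L t → d ∈ t → (fun z : ι → M => z ∘ f) '' X ⊆ t := by
    intro t ht hdt
    obtain ⟨θ, rfl⟩ := definable_range_iff.1 ht
    rintro _ ⟨z, hz, rfl⟩
    exact h θ hdt z hz
  refine hd ⟨_, himage, by_contra fun hdX => ?_, hsub⟩
  obtain ⟨e, he⟩ := hne.image fun z : ι → M => z ∘ f
  exact hsub _ himage.compl hdX he he

theorem exists_generic_assignments [Nonempty M] [Countable κ] {Γ : κ → Set (L.Formula (α ⊕ ι))}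
    (hΓ : ∀ k (X : Set (ι → M)), (range b).Definable L X → X.Nonempty →
      ∃ χ ∈ Γ k, ∃ z ∈ X, χ.Realize (Sum.elim b z)) :
    ∃ z : ℕ → ι → M, ∀ k, ∃ χ ∈ Γ k, ∀ᶠ j in atTop, χ.Realize (Sum.elim b (z j)) := by
  let P := {X : Set (ι → M) // (range b).Definable L X ∧ X.Nonempty}ᵒᵈ
  have : Nonempty P := ⟨OrderDual.toDual ⟨univ, definable_univ, univ_nonempty⟩⟩
  let D : κ → Set P := fun k =>
    {X | ∃ χ ∈ Γ k, (OrderDual.ofDual X).1 ⊆ {z | χ.Realize (Sum.elim b z)}}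
  have hD : ∀ k, IsCofinal (D k) := by
    rintro k ⟨X, hX, hne⟩
    obtain ⟨χ, hχ, z, hz, hzχ⟩ := hΓ k X hX hne
    exact ⟨OrderDual.toDual ⟨_, hX.inter (definable_range_iff.2 ⟨χ, rfl⟩), z, hz, hzχ⟩,
      ⟨χ, hχ, inter_subset_right⟩, inter_subset_left⟩
  obtain ⟨f, hf, hfD⟩ := exists_generic_seq hD
  choose z hz using fun j => (OrderDual.ofDual (f j)).2.2
  refine ⟨z, fun k => ?_⟩
  obtain ⟨n, χ, hχ, h⟩ := (hfD k).exists
  exact ⟨χ, hχ, eventually_atTop.2 ⟨n, fun j hj => h (hf hj (hz j))⟩⟩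

theorem exists_ultrapower_limit [Nonempty M] (b : α → M) (z : ℕ → ι → M) :
    ∃ (N : Type w) (_ : L.Structure N) (c : α → N) (v : ι → N), ∀ χ : L.Formula (α ⊕ ι),
      (∀ᶠ j in atTop, χ.Realize (Sum.elim b (z j))) → χ.Realize (Sum.elim c v) := by
  let U : Ultrafilter ℕ := hyperfilter ℕ
  let c : α → (U : Filter ℕ).Product fun _ => M := fun a => ((fun _ => b a : ℕ → M) : _)
  let v : ι → (U : Filter ℕ).Product fun _ => M := fun i => ((fun j => z j i : ℕ → M) : _)
  refine ⟨_, inferInstance, c, v, fun χ hχ => ?_⟩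
  convert! (Ultraproduct.realize_formula_cast χ
    (Sum.elim (fun a _ => b a) fun i j => z j i)).2 ?_ using 1
  · ext (a | i) <;> rfl
  · filter_upwards [Nat.hyperfilter_le_atTop hχ] with j hj
    convert! hj using 1
    ext (a | i) <;> rfl

theorem exists_elementarySubstructure_eq_range {v : ι → M}
    (hv : ∀ E : Set M, E.Nonempty → (range (Sum.elim b v)).Definable₁ L E → ∃ i, v i ∈ E) :
    ∃ N : L.ElementarySubstructure M, (N : Set M) = range v ∧ range b ⊆ N := by
  have hmeets : L.MeetsDefinable (range (Sum.elim b v)) := fun E hne hE =>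
    (hv E hne hE).elim fun i hi => ⟨v i, hi, Sum.inr i, rfl⟩
  have hN : (hmeets.toElementarySubstructure : Set M) = range (Sum.elim b v) :=
    hmeets.closure_eq_self
  refine ⟨hmeets.toElementarySubstructure, hN.trans (subset_antisymm (fun x hx => ?_) ?_), ?_⟩
  · exact hv {x} (singleton_nonempty x) (Definable.singleton_of_mem L hx)
  · exact range_subset_iff.2 fun i => ⟨Sum.inr i, rfl⟩
  · exact range_subset_iff.2 fun a => hN.ge ⟨Sum.inl a, rfl⟩

theorem exists_structure_realizing_of_eventually [Nonempty M] {z : ℕ → ι → M}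
    (hz : ∀ φ : L.Formula ((α ⊕ ι) ⊕ Fin 1),
      ∃ i, ∀ᶠ j in atTop, (witnessFormula φ i).Realize (Sum.elim b (z j))) :
    ∃ (N : Type w) (_ : L.Structure N) (c : α → N) (v : ι → N), Function.Surjective v ∧
      ∀ χ : L.Formula (α ⊕ ι), (∀ᶠ j in atTop, χ.Realize (Sum.elim b (z j))) →
        χ.Realize (Sum.elim c v) := by
  obtain ⟨K, _, c, v, hcv⟩ := exists_ultrapower_limit (L := L) b z
  obtain ⟨N, hv, hc⟩ := exists_elementarySubstructure_eq_range (L := L) (b := c) (v := v) <| by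
    rintro E ⟨y, hy⟩ hE
    obtain ⟨φ, hφ⟩ := definable_range_iff.1 hE
    have hφ : ∀ y, y ∈ E ↔ φ.Realize (Sum.elim (Sum.elim c v) fun _ => y) := fun y =>
      Set.ext_iff.1 hφ fun _ => y
    obtain ⟨i, hi⟩ := hz φ
    exact ⟨i, (hφ _).2 (realize_witnessFormula.1 (hcv _ hi) ⟨_, (hφ y).1 hy⟩)⟩
  refine ⟨N, inferInstance, fun a => ⟨c a, hc ⟨a, rfl⟩⟩,
    fun i => ⟨v i, hv.ge ⟨i, rfl⟩⟩, ?_, fun χ hχ => ?_⟩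
  · rintro ⟨x, hx⟩
    obtain ⟨i, hi⟩ := hv.le hx
    exact ⟨i, Subtype.ext hi⟩
  · rw [← N.subtype.map_formula, Sum.comp_elim]
    exact hcv χ hχ

theorem exists_structure_omitting_type [Countable L.Symbols] [Nonempty M] [Countable α] [Finite β]
    {d : β → M} (hd : ¬ IsIsolatedOver L (range b) d) :
    ∃ (N : Type w) (_ : L.Structure N) (c : α → N), SameType L b c ∧
      ∀ e : β → N, ¬ SameType L (Sum.elim b d) (Sum.elim c e) := by
  let Γ : L.Formula ((α ⊕ ℕ) ⊕ Fin 1) ⊕ (β → ℕ) → Set (L.Formula (α ⊕ ℕ)) := Sum.elim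
    (fun φ => range (witnessFormula φ))
    fun σ => {χ | ∃ θ : L.Formula (α ⊕ β), θ.Realize (Sum.elim b d) ∧
      (θ.relabel (Sum.map id σ)).not = χ}
  have hΓ : ∀ k (X : Set (ℕ → M)), (range b).Definable L X → X.Nonempty →
      ∃ χ ∈ Γ k, ∃ z ∈ X, χ.Realize (Sum.elim b z) := by
    rintro (φ | σ) X hX hne
    · obtain ⟨i, hi⟩ := exists_realize_witnessFormula φ hX hne
      exact ⟨_, ⟨i, rfl⟩, hi⟩
    · obtain ⟨θ, hθ, z, hz, hzθ⟩ := exists_realize_and_exists_not_realize hd hX hne σ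
      exact ⟨_, ⟨θ, hθ, rfl⟩, z, hz, by
        rwa [Formula.realize_not, Formula.realize_relabel, Sum.elim_comp_map]⟩
  obtain ⟨z, hz⟩ := exists_generic_assignments hΓ
  obtain ⟨N, _, c, v, hv, hcv⟩ := exists_structure_realizing_of_eventually fun φ => by
    obtain ⟨_, ⟨i, rfl⟩, hi⟩ := hz (Sum.inl φ)
    exact ⟨i, hi⟩
  refine ⟨N, _, c, sameType_of_forall_imp fun φ hφ => ?_, fun e he => ?_⟩
  · have := hcv (φ.relabel Sum.inl) (Eventually.of_forall fun _ => by
      rwa [Formula.realize_relabel, Sum.elim_comp_inl])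
    rwa [Formula.realize_relabel, Sum.elim_comp_inl] at this
  · obtain ⟨σ, rfl⟩ : ∃ σ, v ∘ σ = e := hv.comp_left e
    obtain ⟨_, ⟨θ, hθ, rfl⟩, hσ⟩ := hz (Sum.inr σ)
    have := hcv _ hσ
    rw [Formula.realize_not, Formula.realize_relabel, Sum.elim_comp_map] at this
    exact this ((he θ).1 hθ)

theorem isAtomicOver_of_isPrimeOver [Countable L.Symbols] [Nonempty M] {m : ℕ} {b : Fin m → M}
    (hb : L.IsPrimeOver b) : IsAtomicOver L (range b) := by
  intro n d
  by_contra hd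
  obtain ⟨N, _, c, hbc, hN⟩ := exists_structure_omitting_type hd
  obtain ⟨f, rfl⟩ := hb N c hbc
  refine hN (f ∘ d) ?_
  rw [← Sum.comp_elim]
  exact sameType_comp_elementaryEmbedding f (Sum.elim b d)

end Generic

section CompleteTheory

variable {L : FirstOrder.Language.{u, v}} {M : Type w} [L.Structure M]

theorem sameType_empty_of_model {N : Type*} [L.Structure N] [N ⊨ L.completeTheory M] :
    SameType L (default : Empty → M) (default : Empty → N) :=
  fun φ => (realize_iff_of_model_completeTheory M N φ).symm

variable {n : ℕ}

theorem sameType_of_isolates_of_model {N : Type*} [L.Structure N] [N ⊨ L.completeTheory M]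
    {ψ : L.Formula (Fin n)} {d : Fin n → M} (hψ : ∀ e : Fin n → M, ψ.Realize e → SameType L d e)
    {e : Fin n → N} (he : ψ.Realize e) : SameType L d e := by
  refine sameType_sumElim_iff_of_isEmpty.1
    (sameType_empty_of_model.sumElim_of_isolates (ψ := ψ.relabel Sum.inr) (fun e' he' => ?_) ?_)
  · rw [Formula.realize_relabel, Sum.elim_comp_inr] at he'
    exact sameType_sumElim_iff_of_isEmpty.2 (hψ e' he')
  · rwa [Formula.realize_relabel, Sum.elim_comp_inr]

theorem exists_realize_iff_of_model {N : Type*} [L.Structure N] [N ⊨ L.completeTheory M]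
    (φ : L.Formula (Fin n)) : (∃ d : Fin n → M, φ.Realize d) ↔ ∃ e : Fin n → N, φ.Realize e := by
  simpa only [Formula.realize_relabel, Sum.elim_comp_inr] using
    sameType_empty_of_model.exists_realize_iff (φ.relabel Sum.inr)

variable [Nonempty M]

theorem isConsistentFormula_completeTheory_iff {φ : L.Formula (Fin n)} :
    (L.completeTheory M).IsConsistentFormula φ ↔ ∃ d : Fin n → M, φ.Realize d := by
  refine ⟨fun ⟨N, hN⟩ => (exists_realize_iff_of_model φ).2 hN, fun h => ?_⟩
  obtain ⟨N⟩ : (L.completeTheory M).IsSatisfiable := completeTheory.isSatisfiable L M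
  exact ⟨N, (exists_realize_iff_of_model φ).1 h⟩

theorem typeOf_eq_typeOf_iff {T : L.Theory} {α : Type*} {K K' : Type*} [L.Structure K]
    [L.Structure K'] [K ⊨ T] [K' ⊨ T] [Nonempty K] [Nonempty K'] {d : α → K} {e : α → K'} :
    T.typeOf d = T.typeOf e ↔ SameType L d e := by
  rw [SetLike.ext_iff, ← Formula.equivSentence.forall_congr_right]
  simp only [Theory.CompleteType.formula_mem_typeOf, SameType]

theorem isIsolated_typeOf_iff {d : Fin n → M} :
    ((L.completeTheory M).typeOf d).IsIsolated ↔ IsIsolatedOver L (∅ : Set M) d := by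
  rw [isIsolatedOver_empty_iff, Theory.CompleteType.IsIsolated]
  refine exists_congr fun ψ => and_congr Theory.CompleteType.formula_mem_typeOf ⟨fun h e he => ?_,
    fun h q hq => ?_⟩
  · have := h _ (Theory.CompleteType.formula_mem_typeOf.2 he)
    exact (typeOf_eq_typeOf_iff (T := L.completeTheory M)).1 this.symm
  · obtain ⟨N, e, rfl⟩ := Theory.exists_modelType_is_realized_in _ q
    rw [Theory.CompleteType.formula_mem_typeOf] at hq
    exact (typeOf_eq_typeOf_iff.2 (sameType_of_isolates_of_model (M := M) h hq)).symm

theorem exists_typeOf_eq_of_isIsolated {p : (L.completeTheory M).CompleteType (Fin n)}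
    (hp : p.IsIsolated) : ∃ d : Fin n → M, (L.completeTheory M).typeOf d = p := by
  obtain ⟨ψ, hψp, hψ⟩ := hp
  obtain ⟨N, e, rfl⟩ := Theory.exists_modelType_is_realized_in _ p
  rw [Theory.CompleteType.formula_mem_typeOf] at hψp
  obtain ⟨d, hd⟩ := (exists_realize_iff_of_model (M := M) ψ).2 ⟨e, hψp⟩
  exact ⟨d, hψ _ (Theory.CompleteType.formula_mem_typeOf.2 hd)⟩

theorem isIFormula_completeTheory_iff {φ : L.Formula (Fin n)} :
    (L.completeTheory M).IsIFormula φ ↔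
      ∃ d : Fin n → M, φ.Realize d ∧ IsIsolatedOver L (∅ : Set M) d := by
  rw [Theory.IsIFormula, isConsistentFormula_completeTheory_iff]
  constructor
  · rintro ⟨_, p, hp, hφ⟩
    obtain ⟨d, rfl⟩ := exists_typeOf_eq_of_isIsolated hp
    exact ⟨d, Theory.CompleteType.formula_mem_typeOf.1 hφ, isIsolated_typeOf_iff.1 hp⟩
  · rintro ⟨d, hd, hi⟩
    exact ⟨⟨d, hd⟩, _, isIsolated_typeOf_iff.2 hi, Theory.CompleteType.formula_mem_typeOf.2 hd⟩

theorem isolatedTypesDense_empty_iff :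
    IsolatedTypesDense L (∅ : Set M) ↔ ∀ (n : ℕ) (φ : L.Formula (Fin n)),
      (L.completeTheory M).IsConsistentFormula φ → (L.completeTheory M).IsIFormula φ := by
  simp only [isIFormula_completeTheory_iff, isConsistentFormula_completeTheory_iff]
  refine forall_congr' fun n => ⟨fun h φ => h _ (empty_definable_iff.2 ⟨φ, rfl⟩), fun h s hs => ?_⟩
  obtain ⟨φ, rfl⟩ := empty_definable_iff.1 hs
  exact h φ

end CompleteTheory

section Constants

variable {L : FirstOrder.Language.{u, v}} {M : Type w} [L.Structure M] {m : ℕ} {b : Fin m → M}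

theorem empty_definable_constantsOn_iff {α : Type*} {s : Set (α → M)} :
    letI : (constantsOn (Fin m)).Structure M := constantsOn.structure b
    (∅ : Set M).Definable L[[Fin m]] s ↔ (range b).Definable L s := by
  let _ : (constantsOn (Fin m)).Structure M := constantsOn.structure b
  rw [empty_definable_iff, definable_range_iff,
    _root_.Equiv.exists_congr_left BoundedFormula.constantsVarsEquiv.symm]
  refine exists_congr fun φ => iff_of_eq (congrArg (s = ·) ?_)
  ext e
  rw [_root_.Equiv.symm_symm]
  exact (BoundedFormula.realize_constantsVarsEquiv (xs := default)).symm

theorem allConsistentAreIFormulas_iff [Nonempty M] :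
    L.AllConsistentAreIFormulas b ↔ IsolatedTypesDense L (range b) := by
  let _ : (constantsOn (Fin m)).Structure M := constantsOn.structure b
  refine (isolatedTypesDense_empty_iff (L := L[[Fin m]]) (M := M)).symm.trans ?_
  simp only [IsolatedTypesDense, IsIsolatedOver, empty_definable_constantsOn_iff (b := b)]

end Constants

section ElementaryEmbedding

variable {L : FirstOrder.Language.{u, v}} {M N : Type*} [L.Structure M] [L.Structure N]
variable {α β : Type*} {b : α → N}

theorem isIsolatedOver_comp_elementaryEmbedding_iff [Finite β] (f : N ↪ₑ[L] M) {d : β → N} :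
    IsIsolatedOver L (range (f ∘ b)) (f ∘ d) ↔ IsIsolatedOver L (range b) d := by
  simp only [isIsolatedOver_range_iff, ← Sum.comp_elim, f.map_formula]
  refine exists_congr fun ψ => and_congr_right fun _ => ⟨fun h e he χ => ?_, fun h e he χ => ?_⟩
  · have := h (f ∘ e) (by rwa [← Sum.comp_elim, f.map_formula]) χ
    rwa [← Sum.comp_elim, f.map_formula, f.map_formula] at this
  · rw [f.map_formula]
    exact (sameType_comp_elementaryEmbedding f b).sumElim_of_isolates h he χ

theorem isolatedTypesDense_comp_elementaryEmbedding (f : N ↪ₑ[L] M)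
    (h : IsolatedTypesDense L (range b)) : IsolatedTypesDense L (range (f ∘ b)) := by
  rintro n s hs ⟨x, hx⟩
  obtain ⟨φ, rfl⟩ := definable_range_iff.1 hs
  obtain ⟨d₀, hd₀⟩ :=
    ((sameType_comp_elementaryEmbedding f b).exists_realize_iff φ).2 ⟨x, hx⟩
  obtain ⟨d, hd, hi⟩ := h n _ (definable_range_iff.2 ⟨φ, rfl⟩) ⟨d₀, hd₀⟩
  refine ⟨f ∘ d, ?_, (isIsolatedOver_comp_elementaryEmbedding_iff f).2 hi⟩
  rw [mem_ofPred_eq, ← Sum.comp_elim, f.map_formula]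
  exact hd

end ElementaryEmbedding

section Chain

variable {L : FirstOrder.Language.{u, v}} {M : Type w} [L.Structure M] {S : ℕ → L.Substructure M}

theorem isElementaryChain_of_isElementary (hS : ∀ n, (S n).IsElementary) (hmono : Monotone S) :
    IsElementaryChain S :=
  ⟨fun n => hmono n.le_succ, fun n _ φ x => (hS (n + 1) φ _).symm.trans (hS n φ x)⟩

theorem monotone_of_isElementaryChain (h : IsElementaryChain S) : Monotone S :=
  monotone_nat_of_le_succ h.le_succ

theorem realize_inclusion_of_isElementaryChain (h : IsElementaryChain S) {n k : ℕ} (hnk : n ≤ k)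
    {l : ℕ} (φ : L.Formula (Fin l)) (x : Fin l → S n) :
    φ.Realize (Substructure.inclusion (monotone_of_isElementaryChain h hnk) ∘ x) ↔ φ.Realize x := by
  induction k, hnk using Nat.le_induction with
  | base => rfl
  | succ k hnk ih =>
    rw [← ih]
    exact h.elementary k l φ (Substructure.inclusion (monotone_of_isElementaryChain h hnk) ∘ x)

theorem realize_boundedFormula_subtype_iff (h : IsElementaryChain S)
    (hS : ∀ x : M, ∃ n, x ∈ S n) {l : ℕ} (φ : L.BoundedFormula Empty l) {n : ℕ}
    (x : Fin l → S n) : φ.Realize default ((S n).subtype ∘ x) ↔ φ.Realize default x := by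
  induction φ generalizing n with
  | falsum => exact Iff.rfl
  | equal t₁ t₂ =>
    simp only [BoundedFormula.Realize]
    rw [Subsingleton.elim (default : Empty → M) ((S n).subtype ∘ default), ← Sum.comp_elim,
      HomClass.realize_term, HomClass.realize_term, (S n).subtype.injective.eq_iff]
  | rel R ts =>
    simp only [BoundedFormula.Realize]
    rw [Subsingleton.elim (default : Empty → M) ((S n).subtype ∘ default), ← Sum.comp_elim]
    simp only [HomClass.realize_term]
    exact (S n).subtype.map_rel R _
  | imp _ _ ih₁ ih₂ => rw [BoundedFormula.realize_imp, BoundedFormula.realize_imp, ih₁, ih₂]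
  | @all l φ ih =>
    simp only [BoundedFormula.realize_all]
    refine ⟨fun H a => ?_, fun H a => ?_⟩
    · rw [← ih, Fin.comp_snoc]
      exact H a
    · obtain ⟨k, hk⟩ := hS a
      let f : S n ↪ₑ[L] S (max n k) :=
        ⟨Substructure.inclusion (monotone_of_isElementaryChain h (le_max_left n k)),
          fun _ φ x => realize_inclusion_of_isElementaryChain h (le_max_left n k) φ x⟩
      have hf := (f.map_boundedFormula φ.all default x).2 H
        ⟨a, monotone_of_isElementaryChain h (le_max_right n k) hk⟩
      rwa [Subsingleton.elim (f ∘ default) default, ← ih, Fin.comp_snoc] at hf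

theorem isElementary_of_isElementaryChain (h : IsElementaryChain S)
    (hS : ∀ x : M, ∃ n, x ∈ S n) (n : ℕ) : (S n).IsElementary := fun _ φ x =>
  φ.realize_relabel_sumInr.symm.trans
    ((realize_boundedFormula_subtype_iff h hS _ x).trans φ.realize_relabel_sumInr)

end Chain

section IsolatedExtension

variable {L : FirstOrder.Language.{u, v}} {M : Type*} [L.Structure M] {A : Set M} {B C D : Finset M}

variable (L) in
/-- `C` extends `B` and the complete type over `B` of an enumeration of `C` is isolated. -/
def IsIsolatedExtension (B C : Finset M) : Prop :=
  B ⊆ C ∧ IsIsolatedOver L (B : Set M) ((↑) : C → M)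

theorem IsIsolatedExtension.refl (B : Finset M) : IsIsolatedExtension L B B :=
  ⟨subset_rfl, isIsolatedOver_of_forall_mem Subtype.property⟩

theorem IsIsolatedExtension.union_range (h : IsIsolatedExtension L B C) :
    (B : Set M) ∪ range ((↑) : C → M) = C := by
  rw [Subtype.range_coe_subtype, Finset.setOfPred_mem]
  exact union_eq_right.2 (Finset.coe_subset.2 h.1)

theorem IsIsolatedExtension.trans (hBC : IsIsolatedExtension L B C)
    (hCD : IsIsolatedExtension L C D) : IsIsolatedExtension L B D :=
  ⟨hBC.1.trans hCD.1,
    (hBC.2.sumElim (by rw [hBC.union_range]; exact hCD.2)).comp Sum.inr⟩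

theorem isIsolatedExtension_insert [DecidableEq M] {x : Fin 1 → M}
    (hx : IsIsolatedOver L (B : Set M) x) : IsIsolatedExtension L B (insert (x 0) B) := by
  refine ⟨Finset.subset_insert _ _, hx.of_forall_mem_union ?_⟩
  rintro ⟨y, hy⟩
  obtain rfl | hy := Finset.mem_insert.1 hy
  exacts [Or.inr ⟨0, rfl⟩, Or.inl hy]

theorem IsIsolatedExtension.isolatedTypesDense (h : IsIsolatedExtension L B C)
    (hB : IsolatedTypesDense L (B : Set M)) : IsolatedTypesDense L (C : Set M) := by
  rw [← h.union_range]
  exact hB.union_range h.2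

theorem IsIsolatedExtension.isIsolatedOver (h : IsIsolatedExtension L B C) {β : Type*} [Finite β]
    {d : β → M} (hd : ∀ i, d i ∈ C) : IsIsolatedOver L (B : Set M) d :=
  h.2.comp fun i => ⟨d i, hd i⟩

theorem IsolatedTypesDense.exists_subset_forall_isIsolatedOver (hA : IsolatedTypesDense L A)
    {n : ℕ} {s : Set (Fin n → M)} (hs : A.Definable L s) (hne : s.Nonempty) :
    ∃ r ⊆ s, A.Definable L r ∧ r.Nonempty ∧ ∀ x ∈ r, IsIsolatedOver L A x := by
  obtain ⟨d, hds, p, hp, hdp, hp'⟩ := hA n s hs hne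
  exact ⟨p ∩ s, inter_subset_right, hp.inter hs, ⟨d, hdp, hds⟩, fun x hx =>
    ⟨p, hp, hx.1, fun t ht hxt => subset_of_isolates hp' hx.1 ht hxt⟩⟩

theorem exists_forall_isIsolatedOver_of_monotone {A : ℕ → Set M} (hA : Monotone A) {k : ℕ}
    (hdense : ∀ j < k, IsolatedTypesDense L (A j)) {n i : ℕ} {s : Set (Fin n → M)}
    (hs : (A i).Definable L s) (hne : s.Nonempty) :
    ∃ x ∈ s, ∀ j, i ≤ j → j < k → IsIsolatedOver L (A j) x := by
  rcases le_or_gt k i with hki | hik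
  · obtain ⟨x, hx⟩ := hne
    exact ⟨x, hx, fun j hij hjk => absurd (hij.trans_lt hjk) hki.not_gt⟩
  · obtain ⟨r, hrs, hr, hrne, hri⟩ := (hdense i hik).exists_subset_forall_isIsolatedOver hs hne
    obtain ⟨x, hxr, hx⟩ := exists_forall_isIsolatedOver_of_monotone hA hdense
      (hr.mono (hA i.le_succ)) hrne
    refine ⟨x, hrs hxr, fun j hij hjk => ?_⟩
    obtain rfl | hij := hij.eq_or_lt
    exacts [hri x hxr, hx j hij hjk]
termination_by k - i

end IsolatedExtension

theorem countable_setOf_definable {L : FirstOrder.Language.{u, v}} [Countable L.Symbols]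
    {M α : Type*} [L.Structure M] [Countable α] {A : Set M} [Countable A] :
    {s : Set (α → M) | A.Definable L s}.Countable :=
  (countable_range fun φ : L.Formula (A ⊕ α) => {x : α → M | φ.Realize (Sum.elim (↑) x)}).mono
    fun _ hs => (definable_iff_exists_formula_sum.1 hs).imp fun _ h => h.symm

section Stages

variable {L : FirstOrder.Language.{u, v}} {M : Type*} [L.Structure M]

variable (L M) in
/-- A finite approximation to an elementary chain whose members are atomic over finite sets: a
finite chain of finite sets over each of which the isolated types are dense. Only the values
`part i` with `i < len` are meaningful. -/
structure ChainStage where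
  /-- The number of members of the chain that have been started. -/
  len : ℕ
  /-- The part of the `i`-th member that has been constructed. -/
  part : ℕ → Finset M
  monotone_part : Monotone part
  dense : ∀ i < len, IsolatedTypesDense L (part i : Set M)

namespace ChainStage

/-- A stage is refined by starting new members and by extending the old ones to isolated extensions,
so that each member stays atomic over what it was when it was started. -/
instance : Preorder (ChainStage L M) where
  le s t := s.len ≤ t.len ∧ ∀ i < s.len, IsIsolatedExtension L (s.part i) (t.part i)
  le_refl s := ⟨le_rfl, fun i _ => .refl (s.part i)⟩
  le_trans _ _ _ hst htr :=
    ⟨hst.1.trans htr.1, fun i hi => (hst.2 i hi).trans (htr.2 i (hi.trans_le hst.1))⟩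

instance : Nonempty (ChainStage L M) := ⟨⟨0, fun _ => ∅, monotone_const, by simp⟩⟩

theorem exists_append (hM : IsCofinal {B : Finset M | IsolatedTypesDense L (B : Set M)})
    (s : ChainStage L M) (a : M) : ∃ t, s ≤ t ∧ t.len = s.len + 1 ∧ a ∈ t.part s.len := by
  classical
  obtain ⟨B, hB, haB⟩ := hM (insert a (s.part s.len))
  refine ⟨⟨s.len + 1, fun i => if i < s.len then s.part i else B, fun i j hij => ?_,
    fun i _ => ?_⟩, ⟨s.len.le_succ, fun i hi => ?_⟩, rfl, ?_⟩
  · dsimp only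
    split_ifs with hi hj hj
    · exact s.monotone_part hij
    · exact (s.monotone_part hi.le).trans ((Finset.subset_insert _ _).trans haB)
    · exact absurd (hij.trans_lt hj) hi
    · exact le_rfl
  · split_ifs with h
    exacts [s.dense i h, hB]
  · dsimp only
    rw [if_pos hi]
    exact .refl _
  · dsimp only
    rw [if_neg (lt_irrefl _)]
    exact haB (Finset.mem_insert_self _ _)

theorem exists_lt_len [Nonempty M]
    (hM : IsCofinal {B : Finset M | IsolatedTypesDense L (B : Set M)}) (s : ChainStage L M)
    (n : ℕ) : ∃ t, s ≤ t ∧ n < t.len := by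
  induction n with
  | zero =>
    obtain ⟨t, hst, ht, -⟩ := exists_append hM s (Classical.arbitrary M)
    exact ⟨t, hst, by lia⟩
  | succ n ih =>
    obtain ⟨t, hst, ht⟩ := ih
    obtain ⟨r, htr, hr, -⟩ := exists_append hM t (Classical.arbitrary M)
    exact ⟨r, hst.trans htr, by lia⟩

theorem exists_witness (s : ChainStage L M) {i : ℕ} {E : Set (Fin 1 → M)}
    (hE : (s.part i : Set M).Definable L E) (hne : E.Nonempty) :
    ∃ t, s ≤ t ∧ ∃ x ∈ E, x 0 ∈ t.part i := by
  classical
  obtain ⟨x, hxE, hx⟩ := exists_forall_isIsolatedOver_of_monotone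
    (A := fun j => (s.part j : Set M)) (fun _ _ h => Finset.coe_subset.2 (s.monotone_part h))
    s.dense hE hne
  let p : ℕ → Finset M := fun j => if i ≤ j then insert (x 0) (s.part j) else s.part j
  have hp : ∀ j < s.len, IsIsolatedExtension L (s.part j) (p j) := fun j hj => by
    by_cases hij : i ≤ j
    · simpa only [p, if_pos hij] using isIsolatedExtension_insert (hx j hij hj)
    · simpa only [p, if_neg hij] using .refl _
  refine ⟨⟨s.len, p, fun j k hjk => ?_, fun j hj => (hp j hj).isolatedTypesDense (s.dense j hj)⟩,
    ⟨le_rfl, hp⟩, x, hxE, ?_⟩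
  · dsimp only [p]
    split_ifs with hj hk hk
    · exact Finset.insert_subset_insert _ (s.monotone_part hjk)
    · exact absurd (hj.trans hjk) hk
    · exact (s.monotone_part hjk).trans (Finset.subset_insert _ _)
    · exact s.monotone_part hjk
  · simp only [p, if_pos le_rfl, Finset.mem_insert_self]

/-- The `i`-th member of the chain approximated by a sequence of stages. -/
def limitPart (s : ℕ → ChainStage L M) (i : ℕ) : Set M :=
  {x | ∀ᶠ j in atTop, x ∈ (s j).part i}

theorem monotone_limitPart (s : ℕ → ChainStage L M) : Monotone (limitPart s) :=
  fun _ _ hik _ hx => hx.mono fun j hj => (s j).monotone_part hik hj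

variable {s : ℕ → ChainStage L M} {i j : ℕ}

theorem part_subset_limitPart (hs : Monotone s) (hij : i < (s j).len) :
    ((s j).part i : Set M) ⊆ limitPart s i := fun _ hx =>
  eventually_atTop.2 ⟨j, fun _ hjk => ((hs hjk).2 i hij).1 hx⟩

theorem isIsolatedOver_part_of_forall_mem_limitPart (hs : Monotone s) (hij : i < (s j).len)
    {β : Type*} [Finite β] {d : β → M} (hd : ∀ l, d l ∈ limitPart s i) :
    IsIsolatedOver L ((s j).part i : Set M) d := by
  obtain ⟨k, hk, hjk⟩ := ((eventually_all.2 hd).and (eventually_ge_atTop j)).exists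
  exact ((hs hjk).2 i hij).isIsolatedOver hk

theorem exists_generic_stages [Countable L.Symbols] [Countable M] [Nonempty M]
    (hM : IsCofinal {B : Finset M | IsolatedTypesDense L (B : Set M)}) :
    ∃ s : ℕ → ChainStage L M, Monotone s ∧ (∀ i, ∃ j, i < (s j).len) ∧
      (∀ a, ∃ i, a ∈ limitPart s i) ∧ ∀ i, L.MeetsDefinable (limitPart s i) := by
  have := (countable_setOf_definable (L := L) (A := (univ : Set M)) (α := Fin 1)).to_subtype
  let D : M ⊕ ℕ × {E : Set (Fin 1 → M) | (univ : Set M).Definable L E} → Set (ChainStage L M) :=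
    Sum.elim (fun a => {s | ∃ i < s.len, a ∈ s.part i})
      fun p => {s | p.1 < s.len ∧ ((s.part p.1 : Set M).Definable L p.2.1 → p.2.1.Nonempty →
        ∃ x ∈ p.2.1, x 0 ∈ s.part p.1)}
  have hD : ∀ r, IsCofinal (D r) := by
    rintro (a | ⟨i, E, -⟩) s
    · obtain ⟨t, hst, ht, ha⟩ := s.exists_append hM a
      exact ⟨t, ⟨s.len, by lia, ha⟩, hst⟩
    · obtain ⟨t, hst, hi⟩ := s.exists_lt_len hM i
      by_cases h : (t.part i : Set M).Definable L E ∧ E.Nonempty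
      · obtain ⟨r, htr, hr⟩ := t.exists_witness h.1 h.2
        exact ⟨r, ⟨hi.trans_le htr.1, fun _ _ => hr⟩, hst.trans htr⟩
      · exact ⟨t, ⟨hi, fun h₁ h₂ => absurd ⟨h₁, h₂⟩ h⟩, hst⟩
  obtain ⟨s, hs, hsD⟩ := exists_generic_seq hD
  refine ⟨s, hs, fun i => ?_, fun a => ?_, fun i E hne hE => ?_⟩
  · obtain ⟨j, hj, -⟩ := (hsD (Sum.inr (i, ⟨univ, definable_univ⟩))).exists
    exact ⟨j, hj⟩
  · obtain ⟨j, i, hij, ha⟩ := (hsD (Sum.inl a)).exists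
    exact ⟨i, part_subset_limitPart hs hij ha⟩
  · obtain ⟨A, hA, hAE⟩ := definable_iff_finitely_definable.1 hE
    have hev : ∀ᶠ j in atTop, A ⊆ (s j).part i := (A.eventually_all (l := atTop)).2 hA
    obtain ⟨j, ⟨hij, hj⟩, hAj⟩ :=
      ((hsD (Sum.inr (i, ⟨_, hE.mono (subset_univ _)⟩))).and_eventually hev).exists
    obtain ⟨y, hy⟩ := hne
    obtain ⟨x, hxE, hx⟩ := hj (hAE.mono (Finset.coe_subset.2 hAj)) ⟨fun _ => y, hy⟩
    exact ⟨x 0, hxE, part_subset_limitPart hs hij hx⟩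

end ChainStage

end Stages

section ChainConstruction

variable {L : FirstOrder.Language.{u, v}} {M : Type*} [L.Structure M]

theorem isPrimeOverFinite_of_elementaryEmbedding {N : Type w} [L.Structure N] [Countable N]
    [Nonempty N] (f : N ↪ₑ[L] M) {A : Finset M} (hA : (A : Set M) ⊆ range f)
    (h : ∀ (n : ℕ) (d : Fin n → N), IsIsolatedOver L (A : Set M) (f ∘ d)) :
    L.IsPrimeOverFinite N := by
  choose b hb using fun i : Fin A.card => hA (A.equivFin.symm i).2
  have hrange : range (f ∘ b) = A := by
    rw [show f ∘ b = (↑) ∘ A.equivFin.symm from funext hb,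
      A.equivFin.symm.surjective.range_comp, Subtype.range_coe_subtype, Finset.setOfPred_mem]
  refine ⟨A.card, b, IsAtomicOver.isPrimeOver fun n d => ?_⟩
  rw [← isIsolatedOver_comp_elementaryEmbedding_iff f, hrange]
  exact h n d

theorem exists_isElementaryChain [Countable L.Symbols] [Countable M] [Nonempty M]
    (hM : IsCofinal {B : Finset M | IsolatedTypesDense L (B : Set M)}) :
    ∃ S : ℕ → L.Substructure M, IsElementaryChain S ∧
      (∀ n, L.IsPrimeOverFinite (S n)) ∧ ∀ x : M, ∃ n, x ∈ S n := by
  obtain ⟨s, hs, hlen, hcover, hmeets⟩ := ChainStage.exists_generic_stages hM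
  let N : ℕ → L.ElementarySubstructure M := fun i => (hmeets i).toElementarySubstructure
  have hN : ∀ {i x}, x ∈ N i ↔ x ∈ ChainStage.limitPart s i := fun {i x} =>
    Set.ext_iff.1 (hmeets i).closure_eq_self x
  refine ⟨fun i => N i, isElementaryChain_of_isElementary (fun i => (N i).isElementary)
    fun i j hij x hx => hN.2 (ChainStage.monotone_limitPart s hij (hN.1 hx)), fun i => ?_,
    fun x => (hcover x).imp fun _ => hN.2⟩
  have : Nonempty (N i) := by
    obtain ⟨x, -, hx⟩ := hmeets i univ univ_nonempty definable_univ
    exact ⟨⟨x, hN.2 hx⟩⟩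
  obtain ⟨j, hij⟩ := hlen i
  refine isPrimeOverFinite_of_elementaryEmbedding (N i).subtype (A := (s j).part i)
    (fun x hx => ⟨⟨x, hN.2 (ChainStage.part_subset_limitPart hs hij hx)⟩, rfl⟩) fun n d => ?_
  exact ChainStage.isIsolatedOver_part_of_forall_mem_limitPart hs hij fun l => hN.1 (d l).2

end ChainConstruction

section Characterization

theorem range_finAppend {α : Type*} {m n : ℕ} (a : Fin m → α) (b : Fin n → α) :
    range (Fin.append a b) = range a ∪ range b := by
  rw [← Sum.elim_range, ← Fin.append_comp_sumElim]
  exact (finSumFinEquiv.surjective.range_comp (Fin.append a b)).symm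

variable {L : FirstOrder.Language.{u, v}} {M : Type w} [L.Structure M]

theorem isNplZero_iff {T : L.Theory} :
    Theory.IsNplZero.{u, v, w} T ↔ ∀ (M : Type w) [L.Structure M] [Nonempty M] [Countable M]
      [M ⊨ T], L.IsPrimeOverFinite M ∨ L.IsLimitModel M := by
  rw [Theory.IsNplZero, mk_eq_zero_iff, isEmpty_coe_sort, eq_empty_iff_forall_notMem]
  constructor
  · intro h M _ _ hM _
    by_contra! hn
    exact h _ ⟨⟨Theory.ModelType.of T M, hM⟩, rfl, hn⟩
  · rintro h _ ⟨⟨M, hM⟩, rfl, hn⟩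
    exact (not_or.2 hn) (h M)

theorem exists_forall_mem_of_monotone {ι : Type*} [Finite ι] {S : ℕ → L.Substructure M}
    (hS : Monotone S) (hM : ∀ x, ∃ n, x ∈ S n) (a : ι → M) : ∃ n, ∀ i, a i ∈ S n := by
  have hev : ∀ i, ∀ᶠ n in atTop, a i ∈ S n := fun i =>
    (hM (a i)).elim fun k hk => eventually_atTop.2 ⟨k, fun _ hkn => hS hkn hk⟩
  exact (eventually_all.2 hev).exists

variable [Nonempty M]

theorem isCofinal_isolatedTypesDense (h : L.TuplesExtendToIFormulaTuples M) :
    IsCofinal {B : Finset M | IsolatedTypesDense L (B : Set M)} := by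
  classical
  intro A
  obtain ⟨k, c, hc⟩ := h A.card ((↑) ∘ A.equivFin.symm)
  rw [allConsistentAreIFormulas_iff, range_finAppend, A.equivFin.symm.surjective.range_comp,
    Subtype.range_coe_subtype, Finset.setOfPred_mem] at hc
  refine ⟨A ∪ Finset.univ.image c, ?_, Finset.subset_union_left⟩
  simpa only [mem_ofPred_eq, Finset.coe_union, Finset.coe_image, Finset.coe_univ, image_univ]
    using hc

theorem isolatedTypesDense_append_of_isPrimeOver [Countable L.Symbols] {m n : ℕ} {b : Fin m → M}
    (hb : L.IsPrimeOver b) (a : Fin n → M) : IsolatedTypesDense L (range (Fin.append a b)) := by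
  rw [range_finAppend, union_comm]
  exact (isAtomicOver_of_isPrimeOver hb).isolatedTypesDense_union_range a

theorem tuplesExtendToIFormulaTuples_of_isPrimeOverFinite [Countable L.Symbols]
    (h : L.IsPrimeOverFinite M) : L.TuplesExtendToIFormulaTuples M := by
  obtain ⟨m, b, hb⟩ := h
  exact fun n a =>
    ⟨m, b, allConsistentAreIFormulas_iff.2 (isolatedTypesDense_append_of_isPrimeOver hb a)⟩

theorem nonempty_of_elementaryEmbedding {N : Type*} [L.Structure N] (f : N ↪ₑ[L] M) :
    Nonempty N := by
  obtain ⟨x⟩ := ‹Nonempty M›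
  obtain ⟨y, -⟩ := ((sameType_comp_elementaryEmbedding f Fin.elim0).exists_realize_iff
    (⊤ : L.Formula (Fin 0 ⊕ Fin 1))).2 ⟨fun _ => x, Formula.realize_top.2 trivial⟩
  exact ⟨y 0⟩

theorem tuplesExtendToIFormulaTuples_of_isLimitModel [Countable L.Symbols]
    (h : L.IsLimitModel M) : L.TuplesExtendToIFormulaTuples M := by
  obtain ⟨-, S, hS, hprime, hM⟩ := h
  intro n a
  obtain ⟨k, hk⟩ := exists_forall_mem_of_monotone (monotone_of_isElementaryChain hS) hM a
  let f : S k ↪ₑ[L] M := ⟨(S k).subtype, fun _ φ x => isElementary_of_isElementaryChain hS hM k φ x⟩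
  have := nonempty_of_elementaryEmbedding f
  obtain ⟨m, b, hb⟩ := hprime k
  let a' : Fin n → S k := fun i => ⟨a i, hk i⟩
  have happend : f ∘ Fin.append a' b = Fin.append a (f ∘ b) := by
    funext i
    induction i using Fin.addCases with
    | left i => simp only [Function.comp_apply, Fin.append_left]; rfl
    | right i => simp only [Function.comp_apply, Fin.append_right]
  refine ⟨m, f ∘ b, allConsistentAreIFormulas_iff.2 ?_⟩
  rw [← happend]
  exact isolatedTypesDense_comp_elementaryEmbedding f
    (isolatedTypesDense_append_of_isPrimeOver hb a')

theorem isPrimeOverFinite_or_isLimitModel_iff [Countable L.Symbols] [Countable M] :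
    (L.IsPrimeOverFinite M ∨ L.IsLimitModel M) ↔ L.TuplesExtendToIFormulaTuples M := by
  refine ⟨fun h => h.elim tuplesExtendToIFormulaTuples_of_isPrimeOverFinite
    tuplesExtendToIFormulaTuples_of_isLimitModel, fun h => ?_⟩
  by_cases hp : L.IsPrimeOverFinite M
  · exact Or.inl hp
  · exact Or.inr ⟨hp, exists_isElementaryChain (isCofinal_isolatedTypesDense h)⟩

end Characterization

end PrimeModels

theorem theorem5p2_general {L : FirstOrder.Language.{u, v}} [Countable L.Symbols] (T : L.Theory) :
    (∀ (M : Type w) [L.Structure M] [Nonempty M] [Countable M],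
      (L.IsPrimeOverFinite M ∨ L.IsLimitModel M) ↔ L.TuplesExtendToIFormulaTuples M) ∧
    (FirstOrder.Language.Theory.IsNplZero.{u, v, w} T ↔
      ∀ (M : Type w) [L.Structure M] [Nonempty M] [Countable M] [M ⊨ T],
        L.TuplesExtendToIFormulaTuples M) := by
  refine ⟨fun M _ _ _ => PrimeModels.isPrimeOverFinite_or_isLimitModel_iff, ?_⟩
  exact PrimeModels.isNplZero_iff.trans <| forall_congr' fun M => forall₄_congr fun _ _ _ _ =>
    PrimeModels.isPrimeOverFinite_or_isLimitModel_iff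

theorem theorem5p2 {L : FirstOrder.Language.{u, v}} (T : L.Theory) (hT : T.IsUnsmall) :
    (∀ (M : Type w) [L.Structure M] [Nonempty M] [Countable M] [M ⊨ T],
      (L.IsPrimeOverFinite M ∨ L.IsLimitModel M) ↔ L.TuplesExtendToIFormulaTuples M) ∧
    (FirstOrder.Language.Theory.IsNplZero.{u, v, w} T ↔
      ∀ (M : Type w) [L.Structure M] [Nonempty M] [Countable M] [M ⊨ T],
        L.TuplesExtendToIFormulaTuples M) := by
  have := hT.countable
  exact ⟨fun M _ _ _ _ => (theorem5p2_general T).1 M, (theorem5p2_general T).2⟩
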